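/- Graphs are finite, simple, undirected and connected; $n$ denotes the number of vertices of a graph $G$, $d_G$ its distance and $I(u,v)=\{x : d_G(u,x)+d_G(x,v)=d_G(u,v)\}$. A graph is \emph{median} if $I(x,y)\cap I(y,z)\cap I(z,x)$ is a single vertex for all vertices $x,y,z$. A \emph{port assignment} of $G$ gives, at every vertex $u$, to the edges leaving $u$ distinct integers from $\{1,\dots,\deg(u)\}$; the integer given to the edge from $u$ to $w$ is $\mathrm{port}(u,w)$. A \emph{distance labeling scheme} on a family $\mathcal G$ of graphs consists of an encoding function $C_G:V(G)\to\{0,1\}^*$ for every $G\in\mathcal G$ and one decoding function $D:\{0,1\}^*\times\{0,1\}^*\to\mathbb N$, common to all graphs of $\mathcal G$, such that $D(C_G(u),C_G(v))=d_G(u,v)$ for all $G\in\mathcal G$ and $u,v\in V(G)$. A \emph{routing labeling scheme} on $\mathcal G$ consists of an encoding function $C'_G:V(G)\to\{0,1\}^*$ for every $G\in\mathcal G$ with a port assignment and one decoding function $D':\{0,1\}^*\times\{0,1\}^*\to\mathbb N$, common to all graphs of $\mathcal G$ and all port assignments, such that for all $G \in \mathcal G$, all port assignments and all vertices $u\neq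 v$ of $G$, $D'(C'_G(u),C'_G(v))=\mathrm{port}(u,w)$ for some neighbor $w$ of $u$ with $w\in I(u,v)$. \textbf{Proposition.} There is an absolute constant $C$ such that for every integer $\Delta\ge 0$ the family of median graphs of maximum degree at most $\Delta$ admits a distance labeling scheme and a routing labeling scheme in which every label of every $n$-vertex graph of the family has at most $C\cdot 2^{\Delta}(\log_2 n)^3$ bits. -/

import Mathlib

universe u

/-- The interval `I(x, y)`: the vertices lying on shortest `(x, y)`-paths. -/
def SimpleGraph.metricInterval {V : Type u} (G : SimpleGraph V) (x y : V) : Set V :=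
  {m | G.dist x m + G.dist m y = G.dist x y}

/-- A median graph: a connected graph in which `I(x, y) ∩ I(y, z) ∩ I(z, x)` is a singleton
for every triplet of vertices. -/
def SimpleGraph.IsMedianGraph {V : Type u} (G : SimpleGraph V) : Prop :=
  G.Connected ∧ ∀ x y z : V,
    ∃! m : V, m ∈ G.metricInterval x y ∩ G.metricInterval y z ∩ G.metricInterval z x

/-- A family of graphs. -/
abbrev GraphFamily : Type (u + 1) := ∀ V : Type u, SimpleGraph V → Prop

/-- The family of finite median graphs all of whose vertices have degree at most `Δ`. -/
def medianGraphsOfMaxDegree (Δ : ℕ) : GraphFamily.{u} := fun V G =>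
  Finite V ∧ G.IsMedianGraph ∧ ∀ v : V, (G.neighborSet v).ncard ≤ Δ

/-- Ports of a (finite) graph: at every vertex `x` the edges leaving `x` receive distinct integers
ranging from one to the degree of `x`. Only the values `port x y` with `x` adjacent to `y`
have a meaning. -/
structure PortAssignment {V : Type u} (G : SimpleGraph V) where
  /-- the port from `x` to `y` -/
  port : V → V → ℕ
  bijOn : ∀ x : V, Set.BijOn (port x) (G.neighborSet x) (Set.Icc 1 (G.neighborSet x).ncard)

/-- A distance labeling scheme on a family of graphs: the encoding function knows the graph and
gives a bit string to every vertex; the decoding function, which is the same for all graphs of the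
family, returns the distance between two vertices from their two labels only. -/
structure DistanceLabelingScheme (F : GraphFamily.{u}) where
  /-- the encoding function -/
  encode : ∀ {V : Type u} (G : SimpleGraph V), F V G → V → List Bool
  /-- the decoding function -/
  decode : List Bool → List Bool → ℕ
  decode_encode : ∀ {V : Type u} (G : SimpleGraph V) (hG : F V G) (x y : V),
    decode (encode G hG x) (encode G hG y) = G.dist x y

/-- A routing labeling scheme on a family of graphs: the encoding function knows the graph and its
ports and gives a bit string to every vertex; the decoding function, which is the same for all
graphs of the family, returns, from the labels of a source `x` and a target `y ≠ x` only, the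
port from `x` to a neighbor of `x` on a shortest path from `x` to `y`. -/
structure RoutingLabelingScheme (F : GraphFamily.{u}) where
  /-- the encoding function -/
  encode : ∀ {V : Type u} (G : SimpleGraph V), F V G → PortAssignment G → V → List Bool
  /-- the decoding function -/
  decode : List Bool → List Bool → ℕ
  decode_encode : ∀ {V : Type u} (G : SimpleGraph V) (hG : F V G) (P : PortAssignment G)
    (x y : V), x ≠ y → ∃ z : V, G.Adj x z ∧ z ∈ G.metricInterval x y ∧
      decode (encode G hG P x) (encode G hG P y) = P.port x z

/-! Fix a vertex `m` and keep, for each class of parallel edges, the halfspace avoiding `m`;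
distance counts the kept halfspaces separating two vertices (`dist_eq_ncard`). By the Helly
property, an antichain of pairwise intersecting kept halfspaces has at most `Δ` members
(`card_le_of_pairwise_crossing`). Group the halfspaces by the integer part of `log₂` of their size.
Two sets of one group below the same maximal set of the group each fill more than half of it, hence
intersect, and Dilworth's theorem splits them into `Δ` chains. A vertex lies in at most `Δ` maximal
sets per group, so it meets only `O(Δ² log n)` chains (`exists_chain_cover`). The members of a chain
that contain `u` are determined by their number. Recording the nonzero numbers embeds the graph
isometrically into sparse `ℓ₁` vectors with codes of `O(Δ² log² n)` bits. For routing, a vertex also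
stores the labels of its neighbors, which gives `O(Δ³ log² n)` bits, stronger than required. -/

/-! ### Dilworth's theorem -/

/-- **Dilworth's theorem**: a finite set of elements of a partial order whose antichains have at
most `k` elements is covered by `k` chains. -/
theorem exists_chain_coloring {α : Type*} [PartialOrder α] (s : Finset α) (k : ℕ)
    (hs : ∀ t ⊆ s, IsAntichain (· ≤ ·) (t : Set α) → t.card ≤ k) :
    ∃ f : α → ℕ, (∀ x ∈ s, f x < k) ∧ ∀ x ∈ s, ∀ y ∈ s, f x = f y → x ≤ y ∨ y ≤ x := by
  classical
  induction s using Finset.strongInduction generalizing k with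
  | H s ih =>
  rcases s.eq_empty_or_nonempty with rfl | hne
  · exact ⟨fun _ => 0, by simp, by simp⟩
  obtain ⟨a, ha⟩ := s.exists_maximal hne
  have has : a ∈ s := ha.prop
  obtain ⟨k, rfl⟩ : ∃ l, k = l + 1 := by
    have := hs {a} (by simpa using has) (by simp)
    exact ⟨k - 1, by simp at this; omega⟩
  -- it suffices to remove a chain meeting all antichains of the largest size
  have key : ∀ K ⊆ s, a ∈ K → (∀ x ∈ K, ∀ y ∈ K, x ≤ y ∨ y ≤ x) →
      (∀ t ⊆ s \ K, IsAntichain (· ≤ ·) (t : Set α) → t.card ≤ k) →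
      ∃ f : α → ℕ, (∀ x ∈ s, f x < k + 1) ∧
        ∀ x ∈ s, ∀ y ∈ s, f x = f y → x ≤ y ∨ y ≤ x := by
    intro K hK haK hchain hk
    obtain ⟨g, hg, hg'⟩ := ih (s \ K) (Finset.ssubset_iff_of_subset Finset.sdiff_subset |>.2
      ⟨a, has, by simp [haK]⟩) k hk
    refine ⟨fun x => if x ∈ K then k else g x, fun x hx => ?_, fun x hx y hy hxy => ?_⟩
    · by_cases hxK : x ∈ K
      · simp [hxK]
      · have := hg x (by simp [hx, hxK])
        simp only [hxK, if_false]; omega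
    · by_cases hxK : x ∈ K <;> by_cases hyK : y ∈ K
      · exact hchain x hxK y hyK
      · have := hg y (by simp [hy, hyK])
        simp only [hxK, hyK, if_true, if_false] at hxy; omega
      · have := hg x (by simp [hx, hxK])
        simp only [hxK, hyK, if_true, if_false] at hxy; omega
      · simp only [hxK, hyK, if_false] at hxy
        exact hg' x (by simp [hx, hxK]) y (by simp [hy, hyK]) hxy
  by_cases hsmall : ∀ t ⊆ s \ {a}, IsAntichain (· ≤ ·) (t : Set α) → t.card ≤ k
  · exact key {a} (by simpa using has) (by simp) (by simp) hsmall
  push Not at hsmall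
  obtain ⟨t₀, ht₀s, ht₀, ht₀k⟩ := hsmall
  obtain ⟨f, hf, hf'⟩ := ih (s \ {a}) (Finset.ssubset_iff_of_subset Finset.sdiff_subset |>.2
      ⟨a, has, by simp⟩) (k + 1) (fun t ht => hs t (ht.trans Finset.sdiff_subset))
  -- a largest antichain meets every chain
  have hmeet : ∀ t ⊆ s \ {a}, IsAntichain (· ≤ ·) (t : Set α) → k < t.card →
      ∀ i < k + 1, ∃ y ∈ t, f y = i := by
    intro t ht hta htk i hi
    have himg : t.image f = Finset.range (k + 1) := by
      apply Finset.eq_of_subset_of_card_le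
      · intro j hj
        obtain ⟨x, hx, rfl⟩ := Finset.mem_image.1 hj
        exact Finset.mem_range.2 (hf x (ht hx))
      · rw [Finset.card_image_of_injOn, Finset.card_range]
        · omega
        · intro x hx y hy hxy
          rcases hf' x (ht hx) y (ht hy) hxy with h | h
          · exact hta.eq hx hy h
          · exact (hta.eq hy hx h).symm
    have : i ∈ t.image f := by rw [himg]; exact Finset.mem_range.2 hi
    simpa using this
  -- Galvin's argument: in each color, take the largest element `x i` that belongs to some antichain
  -- of size `k + 1`.
  let S : ℕ → Finset α := fun i => (s \ {a}).filter fun x => f x = i ∧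
    ∃ t ⊆ s \ {a}, IsAntichain (· ≤ ·) (t : Set α) ∧ k < t.card ∧ x ∈ t
  have hS : ∀ i < k + 1, ∃ x ∈ S i, ∀ y ∈ S i, y ≤ x := by
    intro i hi
    obtain ⟨y, hy, hyi⟩ := hmeet t₀ ht₀s ht₀ ht₀k i hi
    have hyS : y ∈ S i := Finset.mem_filter.2 ⟨ht₀s hy, hyi, t₀, ht₀s, ht₀, ht₀k, hy⟩
    obtain ⟨x, hx⟩ := (S i).exists_maximal ⟨y, hyS⟩
    refine ⟨x, hx.prop, fun z hz => ?_⟩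
    have h1 := Finset.mem_filter.1 hx.prop
    have h2 := Finset.mem_filter.1 hz
    rcases hf' z h2.1 x h1.1 (h2.2.1.trans h1.2.1.symm) with h | h
    · exact h
    · exact hx.2 hz h
  have : Nonempty α := ⟨a⟩
  choose! x hxS hxmax using hS
  have hxprop := fun i hi => Finset.mem_filter.1 (hxS i hi)
  -- If `x j ≤ x i`, an antichain through `x i` contains some `y` of color `j` with `y ≤ x j ≤ x i`,
  -- forcing `y = x i`.
  have hxanti : ∀ i < k + 1, ∀ j < k + 1, i ≠ j → ¬ x j ≤ x i := by
    intro i hi j hj hij hle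
    obtain ⟨hxis, hfi, t, hts, hta, htk, hxt⟩ := hxprop i hi
    obtain ⟨y, hy, hyj⟩ := hmeet t hts hta htk j hj
    have hyx := hxmax j hj y (Finset.mem_filter.2 ⟨hts hy, hyj, t, hts, hta, htk, hy⟩)
    have := hta.eq hy hxt (hyx.trans hle)
    rw [this, hfi] at hyj
    exact hij hyj
  -- Otherwise `a`, being maximal, forms with all the `x i` an antichain of size `k + 2`.
  obtain ⟨i, hi, hai⟩ : ∃ i < k + 1, x i ≤ a := by
    by_contra! hcon
    have hinj : Set.InjOn x (Finset.range (k + 1) : Set ℕ) := by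
      intro i hi j hj hij
      by_contra hne
      exact hxanti i (by simpa using hi) j (by simpa using hj) hne hij.ge
    have haimg : a ∉ (Finset.range (k + 1)).image x := by
      intro h
      obtain ⟨i, hi, rfl⟩ := Finset.mem_image.1 h
      exact hcon i (by simpa using hi) le_rfl
    have hcard := hs (insert a ((Finset.range (k + 1)).image x)) (by
      intro z hz
      rcases Finset.mem_insert.1 hz with rfl | hz
      · exact has
      · obtain ⟨i, hi, rfl⟩ := Finset.mem_image.1 hz
        exact Finset.sdiff_subset (hxprop i (by simpa using hi)).1) (by
      intro p hp q hq hpq hle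
      simp only [Finset.coe_insert, Finset.coe_image, Set.mem_insert_iff, Set.mem_image,
        Finset.coe_range, Set.mem_Iio] at hp hq
      rcases hp with rfl | ⟨i, hi, rfl⟩ <;> rcases hq with rfl | ⟨j, hj, rfl⟩
      · exact hpq rfl
      · exact hcon j hj (ha.2 (Finset.sdiff_subset (hxprop j hj).1) hle)
      · exact hcon i hi hle
      · exact hxanti j hj i hi (fun h => hpq (by rw [h])) hle)
    rw [Finset.card_insert_of_notMem haimg, Finset.card_image_of_injOn hinj,
      Finset.card_range] at hcard
    omega
  -- An antichain of size `k + 1` has an element of color `i` at most `x i`, so it cannot avoid this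
  -- chain.
  refine key (insert a ((s \ {a}).filter fun z => f z = i ∧ z ≤ x i)) ?_ (by simp) ?_ ?_
  · intro z hz
    rcases Finset.mem_insert.1 hz with rfl | hz
    · exact has
    · exact Finset.sdiff_subset (Finset.mem_filter.1 hz).1
  · intro p hp q hq
    rcases Finset.mem_insert.1 hp with rfl | hp <;> rcases Finset.mem_insert.1 hq with rfl | hq
    · exact Or.inl le_rfl
    · exact Or.inr ((Finset.mem_filter.1 hq).2.2.trans hai)
    · exact Or.inl ((Finset.mem_filter.1 hp).2.2.trans hai)
    · have h1 := Finset.mem_filter.1 hp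
      have h2 := Finset.mem_filter.1 hq
      exact hf' p h1.1 q h2.1 (h1.2.1.trans h2.2.1.symm)
  · intro t ht hta
    by_contra! htk
    have hts : t ⊆ s \ {a} := fun z hz => by
      have := ht hz
      simp only [Finset.mem_sdiff, Finset.mem_insert, not_or] at this
      simpa using ⟨this.1, this.2.1⟩
    obtain ⟨y, hy, hyi⟩ := hmeet t hts hta htk i hi
    have hyx := hxmax i hi y (Finset.mem_filter.2 ⟨hts hy, hyi, t, hts, hta, htk, hy⟩)
    have := ht hy
    simp only [Finset.mem_sdiff, Finset.mem_insert, Finset.mem_filter, not_or] at this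
    have h2 := hts hy
    simp only [Finset.mem_sdiff] at h2
    exact this.2.2 ⟨h2, hyi, hyx⟩

/-! ### Self-delimiting codes -/

/-- A self-delimiting encoding of bit strings. -/
def selfDelimiting : List Bool → List Bool
  | [] => [false]
  | b :: w => true :: b :: selfDelimiting w

/-- An injective encoding of lists of bit strings by bit strings. -/
def encodeStrings (l : List (List Bool)) : List Bool := l.flatMap selfDelimiting

/-- Each bit is announced by `true` and the end by `false`, so the code is prefix-free. -/
theorem selfDelimiting_append_inj {v w : List Bool} {r s : List Bool}
    (h : selfDelimiting v ++ r = selfDelimiting w ++ s) : v = w ∧ r = s := by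
  induction v generalizing w with
  | nil => cases w <;> simp_all [selfDelimiting]
  | cons b v ih =>
    cases w with
    | nil => simp [selfDelimiting] at h
    | cons c w =>
      simp only [selfDelimiting, List.cons_append, List.cons.injEq, true_and] at h
      obtain ⟨rfl, h⟩ := h
      obtain ⟨rfl, rfl⟩ := ih h
      exact ⟨rfl, rfl⟩

theorem encodeStrings_injective : Function.Injective encodeStrings := by
  intro l l' h
  induction l generalizing l' with
  | nil =>
    cases l' with
    | nil => rfl
    | cons w l' => cases w <;> simp [encodeStrings, selfDelimiting] at h
  | cons v l ih =>
    cases l' with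
    | nil => cases v <;> simp [encodeStrings, selfDelimiting] at h
    | cons w l' =>
      obtain ⟨rfl, h'⟩ := selfDelimiting_append_inj (r := encodeStrings l)
        (s := encodeStrings l') (by simpa [encodeStrings] using h)
      rw [ih h']

theorem length_selfDelimiting (w : List Bool) : (selfDelimiting w).length = 2 * w.length + 1 := by
  induction w with
  | nil => rfl
  | cons b w ih => simp [selfDelimiting, ih]; ring

theorem length_encodeStrings_le {l : List (List Bool)} {k : ℕ} (h : ∀ w ∈ l, w.length ≤ k) :
    (encodeStrings l).length ≤ l.length * (2 * k + 1) := by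
  induction l with
  | nil => simp [encodeStrings]
  | cons v l ih =>
    have h1 := ih fun w hw => h w (List.mem_cons_of_mem _ hw)
    have h2 := h v List.mem_cons_self
    simp only [encodeStrings, List.flatMap_cons, List.length_append, length_selfDelimiting,
      List.length_cons] at h1 ⊢
    linarith

/-! ### Binary codes of sparse vectors -/

/-- The vector with values in `ℕ` of finite support given by a list of positions and values. -/
noncomputable def sparseOfList (l : List (ℕ × ℕ)) : ℕ →₀ ℕ :=
  (l.map fun p => Finsupp.single p.1 p.2).sum

/-- The list of positions and values of a vector of finite support. -/
noncomputable def listOfSparse (f : ℕ →₀ ℕ) : List (ℕ × ℕ) :=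
  f.support.toList.map fun c => (c, f c)

/-- The order chosen by `toList` is arbitrary but does not affect the sum. -/
theorem sparseOfList_listOfSparse (f : ℕ →₀ ℕ) : sparseOfList (listOfSparse f) = f := by
  conv_rhs => rw [← Finsupp.sum_single f]
  simp only [sparseOfList, listOfSparse, List.map_map, Finsupp.sum]
  exact Finset.sum_map_toList _ _

/-- The binary encoding of a vector of finite support. -/
noncomputable def encodeSparse (f : ℕ →₀ ℕ) : List Bool :=
  encodeStrings ((listOfSparse f).map fun p => encodeStrings [p.1.bits, p.2.bits])

theorem bits_injective : Function.Injective Nat.bits := by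
  intro m n h
  apply Nat.digits.injective 2
  rw [Nat.digits_two_eq_bits, Nat.digits_two_eq_bits, h]

theorem encodeSparse_injective : Function.Injective encodeSparse := by
  intro f g h
  have h1 := encodeStrings_injective h
  have h2 : Function.Injective fun p : ℕ × ℕ => encodeStrings [p.1.bits, p.2.bits] := by
    intro p q hpq
    have := encodeStrings_injective hpq
    simp only [List.cons.injEq, and_true] at this
    exact Prod.ext (bits_injective this.1) (bits_injective this.2)
  rw [← sparseOfList_listOfSparse f, ← sparseOfList_listOfSparse g, h2.list_map h1]

/-- A pair of `b`-bit numbers costs `2 * (2 * b + 1)` bits, and delimiting it in the outer list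
gives `2 * (4 * b + 2) + 1`. -/
theorem length_encodeSparse_le {f : ℕ →₀ ℕ} {k b : ℕ} (hk : f.support.card ≤ k)
    (hb : ∀ c ∈ f.support, c < 2 ^ b ∧ f c < 2 ^ b) :
    (encodeSparse f).length ≤ k * (8 * b + 5) := by
  have := length_encodeStrings_le (k := 4 * b + 2)
    (l := (listOfSparse f).map fun p => encodeStrings [p.1.bits, p.2.bits]) (by
      intro w hw
      obtain ⟨p, hp, rfl⟩ := List.mem_map.1 hw
      obtain ⟨c, hc, rfl⟩ := List.mem_map.1 hp
      have hc := hb c (by simpa using hc)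
      have := length_encodeStrings_le (k := b) (l := [c.bits, (f c).bits]) (by
        intro w hw
        simp only [List.mem_cons, List.not_mem_nil, or_false] at hw
        rcases hw with rfl | rfl
        · rw [Nat.size_eq_bits_len]; exact Nat.size_le.2 hc.1
        · rw [Nat.size_eq_bits_len]; exact Nat.size_le.2 hc.2)
      simp only [List.length_cons, List.length_nil] at this
      linarith)
  refine this.trans ?_
  simp only [listOfSparse, List.length_map, Finset.length_toList]
  exact Nat.mul_le_mul hk (by omega)

/-! ### Halfspaces of median graphs -/

namespace SimpleGraph

variable {V : Type u} {G : SimpleGraph V}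

/-- The vertices closer to `a` than to `b`. -/
def halfspace (G : SimpleGraph V) (a b : V) : Set V := {x | G.dist x a < G.dist x b}

theorem mem_halfspace {a b x : V} : x ∈ G.halfspace a b ↔ G.dist x a < G.dist x b := Iff.rfl

theorem mem_metricInterval {x y m : V} :
    m ∈ G.metricInterval x y ↔ G.dist x m + G.dist m y = G.dist x y := Iff.rfl

theorem Connected.exists_adj_dist (hG : G.Connected) {x y : V} (hxy : x ≠ y) :
    ∃ z, G.Adj x z ∧ G.dist z y + 1 = G.dist x y := by
  obtain ⟨p, hp⟩ := hG.exists_walk_length_eq_dist x y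
  cases p with
  | nil => exact absurd rfl hxy
  | cons h q =>
    refine ⟨_, h, ?_⟩
    have h1 := dist_le q
    have h2 := hG.dist_triangle (u := x) (v := _) (w := y) |>.trans
      (Nat.add_le_add_right (dist_eq_one_iff_adj.2 h).le _)
    simp only [Walk.length_cons] at hp
    omega

theorem Connected.dist_le_succ (hG : G.Connected) {a b : V} (h : G.Adj a b) (x : V) :
    G.dist x a ≤ G.dist x b + 1 := by
  have := hG.dist_triangle (u := x) (v := b) (w := a)
  rwa [dist_comm (u := b), dist_eq_one_iff_adj.2 h] at this

namespace IsMedianGraph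

theorem exists_median (hG : G.IsMedianGraph) (x y z : V) :
    ∃ m, G.dist x m + G.dist y m = G.dist x y ∧ G.dist y m + G.dist z m = G.dist y z ∧
      G.dist z m + G.dist x m = G.dist z x := by
  obtain ⟨m, ⟨⟨h1, h2⟩, h3⟩, -⟩ := hG.2 x y z
  rw [mem_metricInterval] at h1 h2 h3
  exact ⟨m, by rw [dist_comm (u := y)]; exact h1, by rw [dist_comm (u := z)]; exact h2,
    by rw [dist_comm (u := x) (v := m)]; exact h3⟩

theorem median_unique (hG : G.IsMedianGraph) {x y z m m' : V}
    (h1 : G.dist x m + G.dist y m = G.dist x y) (h2 : G.dist y m + G.dist z m = G.dist y z)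
    (h3 : G.dist z m + G.dist x m = G.dist z x)
    (h1' : G.dist x m' + G.dist y m' = G.dist x y) (h2' : G.dist y m' + G.dist z m' = G.dist y z)
    (h3' : G.dist z m' + G.dist x m' = G.dist z x) : m = m' := by
  refine (hG.2 x y z).unique ⟨⟨?_, ?_⟩, ?_⟩ ⟨⟨?_, ?_⟩, ?_⟩ <;> rw [mem_metricInterval]
  · rwa [dist_comm (u := m)]
  · rwa [dist_comm (u := m)]
  · rwa [dist_comm (u := m)]
  · rwa [dist_comm (u := m')]
  · rwa [dist_comm (u := m')]
  · rwa [dist_comm (u := m')]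

/-- If the distances were equal, the median of `a`, `b`, `x` would be equidistant from `a` and `b`,
yet those two distances sum to one. -/
theorem dist_ne_dist (hG : G.IsMedianGraph) {a b : V} (h : G.Adj a b) (x : V) :
    G.dist x a ≠ G.dist x b := by
  intro heq
  obtain ⟨m, h1, h2, h3⟩ := hG.exists_median a b x
  have hab := dist_eq_one_iff_adj.2 h
  rw [dist_comm (u := b) (v := x)] at h2
  omega

theorem dist_eq_or (hG : G.IsMedianGraph) {a b : V} (h : G.Adj a b) (x : V) :
    G.dist x a = G.dist x b + 1 ∨ G.dist x b = G.dist x a + 1 := by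
  have h1 := hG.1.dist_le_succ h x
  have h2 := hG.1.dist_le_succ h.symm x
  have h3 := hG.dist_ne_dist h x
  omega

theorem notMem_halfspace (hG : G.IsMedianGraph) {a b : V} (h : G.Adj a b) {x : V} :
    x ∉ G.halfspace a b ↔ x ∈ G.halfspace b a := by
  have := hG.dist_ne_dist h x
  rw [mem_halfspace, mem_halfspace]
  omega

theorem compl_halfspace (hG : G.IsMedianGraph) {a b : V} (h : G.Adj a b) :
    (G.halfspace a b)ᶜ = G.halfspace b a := by
  ext x
  exact hG.notMem_halfspace h

theorem mem_halfspace_left {a b : V} (h : G.Adj a b) : a ∈ G.halfspace a b := by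
  rw [mem_halfspace, dist_self, dist_eq_one_iff_adj.2 h]
  exact one_pos

/-- Opposite edges of a square define the same halfspaces. -/
theorem halfspace_subset_of_square (hG : G.IsMedianGraph) {a b a' b' : V} (hab : G.Adj a b)
    (haa : G.Adj a a') (hbb : G.Adj b b') (hab' : G.Adj a' b') (hba : G.dist b a' = 2)
    (hab2 : G.dist a b' = 2) : G.halfspace a b ⊆ G.halfspace a' b' := by
  intro x hx
  by_contra hx'
  rw [hG.notMem_halfspace hab', mem_halfspace] at hx'
  rw [mem_halfspace] at hx
  have h1 := hG.dist_eq_or hab x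
  have h2 := hG.dist_eq_or haa x
  have h3 := hG.dist_eq_or hbb x
  have h4 := hG.dist_eq_or hab' x
  have e1 := dist_eq_one_iff_adj.2 hab
  have e2 := dist_eq_one_iff_adj.2 haa
  have e3 := dist_eq_one_iff_adj.2 hbb
  have e4 := dist_eq_one_iff_adj.2 hab'
  -- Here `a` and `b'` are equidistant from `x`, and `b`, `a'` are one step further. The median `z`
  -- is adjacent to `a` and `b'`, giving a `K₂,₃` in which `a` and `b'` are both medians of `b`,
  -- `a'`, `z`.
  obtain ⟨z, z1, z2, z3⟩ := hG.exists_median a b' x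
  rw [dist_comm (u := b') (v := x)] at z2
  have hza : G.dist a z = 1 := by omega
  have hzb : G.dist b' z = 1 := by omega
  have hxz : G.dist x z + 1 = G.dist x a := by omega
  have hbz : G.dist b z = 2 := by
    have t1 := hG.1.dist_triangle (u := b) (v := a) (w := z)
    have t2 := hG.1.dist_triangle (u := x) (v := z) (w := b)
    rw [dist_comm (u := b) (v := a)] at t1
    rw [dist_comm (u := z) (v := b)] at t2
    omega
  have haz : G.dist a' z = 2 := by
    have t1 := hG.1.dist_triangle (u := a') (v := a) (w := z)
    have t2 := hG.1.dist_triangle (u := x) (v := z) (w := a')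
    rw [dist_comm (u := a') (v := a)] at t1
    rw [dist_comm (u := z) (v := a')] at t2
    omega
  have := hG.median_unique (x := b) (y := a') (z := z) (m := a) (m' := b')
    (by rw [dist_comm (u := b), dist_comm (u := a') (v := a)]; omega)
    (by rw [dist_comm (u := z) (v := a), dist_comm (u := a') (v := a)]; omega)
    (by rw [dist_comm (u := z) (v := a), dist_comm (u := b) (v := a),
      dist_comm (u := z) (v := b)]; omega)
    (by omega)
    (by rw [dist_comm (u := z) (v := b')]; omega)
    (by rw [dist_comm (u := z) (v := b'), dist_comm (u := z) (v := b)]; omega)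
  rw [this, dist_self] at hab2
  omega

theorem halfspace_eq_of_square (hG : G.IsMedianGraph) {a b a' b' : V} (hab : G.Adj a b)
    (haa : G.Adj a a') (hbb : G.Adj b b') (hab' : G.Adj a' b') (hba : G.dist b a' = 2)
    (hab2 : G.dist a b' = 2) : G.halfspace a b = G.halfspace a' b' :=
  (hG.halfspace_subset_of_square hab haa hbb hab' hba hab2).antisymm
    (hG.halfspace_subset_of_square hab' haa.symm hbb.symm hab (by rwa [dist_comm])
      (by rwa [dist_comm]))

/-- An edge leaving a halfspace defines it. -/
theorem halfspace_eq_of_crossing (hG : G.IsMedianGraph) {a b c d : V} (hab : G.Adj a b)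
    (hcd : G.Adj c d) (hc : c ∈ G.halfspace a b) (hd : d ∉ G.halfspace a b) :
    G.halfspace c d = G.halfspace a b := by
  -- A ladder of squares joins `ab` to `cd`: `a'` is the next vertex from `a` toward `c`, and the
  -- median `b'` of `b`, `a'`, `d` closes the first square.
  obtain ⟨k, hk⟩ : ∃ k, G.dist a c = k := ⟨_, rfl⟩
  induction k generalizing a b with
  | zero =>
    obtain rfl := hG.1.dist_eq_zero_iff.1 hk
    rw [hG.notMem_halfspace hab, mem_halfspace] at hd
    rw [dist_comm (u := d) (v := a), dist_eq_one_iff_adj.2 hcd] at hd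
    obtain rfl := hG.1.dist_eq_zero_iff.1 (by omega : G.dist d b = 0)
    rfl
  | succ k ih =>
    have hdb := hd
    rw [hG.notMem_halfspace hab, mem_halfspace] at hdb
    have hca := hc
    rw [mem_halfspace] at hca
    rw [dist_comm (u := c), hk] at hca
    have hab1 := dist_eq_one_iff_adj.2 hab
    have t1 := hG.1.dist_le_succ hcd b
    have t2 := hG.1.dist_le_succ hcd.symm a
    have t3 := hG.1.dist_le_succ hab d
    rw [dist_comm (u := b)] at t1
    rw [dist_comm (u := b)] at t1
    rw [dist_comm (u := a) (v := d)] at t2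
    have hdbk : G.dist d b = k + 1 := by omega
    have hdak : G.dist d a = k + 2 := by omega
    have hcbk : G.dist c b = k + 2 := by omega
    obtain ⟨a', haa, ha'⟩ := hG.1.exists_adj_dist (x := a) (y := c) (by
      rintro rfl; rw [dist_self] at hk; omega)
    have ha'c : G.dist a' c = k := by omega
    have t4 := hG.1.dist_le_succ hcd.symm a'
    have t5 := hG.1.dist_le_succ haa d
    rw [dist_comm (u := d) (v := a')] at t5
    have ha'd : G.dist a' d = k + 1 := by omega
    have haa1 := dist_eq_one_iff_adj.2 haa
    have hba' : G.dist b a' = 2 := by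
      have t6 := hG.1.dist_triangle (u := b) (v := a) (w := a')
      have t7 := hG.1.dist_triangle (u := b) (v := a') (w := c)
      rw [dist_comm (u := b) (v := c)] at t7
      rw [dist_comm (u := b) (v := a)] at t6
      omega
    obtain ⟨b', m1, m2, m3⟩ := hG.exists_median b a' d
    have hbb : G.dist b b' = 1 := by omega
    have hab' : G.dist a' b' = 1 := by omega
    have hdb' : G.dist d b' = k := by omega
    have hab2 : G.dist a b' = 2 := by
      have t6 := hG.1.dist_triangle (u := d) (v := b') (w := a)
      have t7 := hG.1.dist_triangle (u := a) (v := a') (w := b')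
      rw [dist_comm (u := b') (v := a)] at t6
      omega
    have heq := hG.halfspace_eq_of_square hab haa (dist_eq_one_iff_adj.1 hbb)
      (dist_eq_one_iff_adj.1 hab') hba' hab2
    rw [heq] at hc hd ⊢
    exact ih (dist_eq_one_iff_adj.1 hab') hc hd ha'c

end IsMedianGraph

/-! ### Convexity and the Helly property -/

/-- A set of vertices containing all shortest paths between its vertices. -/
def IsGeodesicallyConvex (G : SimpleGraph V) (S : Set V) : Prop :=
  ∀ x ∈ S, ∀ y ∈ S, G.metricInterval x y ⊆ S

theorem IsGeodesicallyConvex.inter {S T : Set V} (hS : G.IsGeodesicallyConvex S)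
    (hT : G.IsGeodesicallyConvex T) : G.IsGeodesicallyConvex (S ∩ T) :=
  fun x hx y hy _ hz => ⟨hS x hx.1 y hy.1 hz, hT x hx.2 y hy.2 hz⟩

namespace IsMedianGraph

/-- If a geodesic toward `y` left the halfspace through an edge, that edge would define the
halfspace, and `y` would lie on the side being left although the step approaches `y`. -/
theorem isGeodesicallyConvex_halfspace (hG : G.IsMedianGraph) {a b : V} (hab : G.Adj a b) :
    G.IsGeodesicallyConvex (G.halfspace a b) := by
  intro x hx y hy z hz
  obtain ⟨k, hk⟩ : ∃ k, G.dist x z = k := ⟨_, rfl⟩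
  induction k generalizing x with
  | zero =>
    obtain rfl := hG.1.dist_eq_zero_iff.1 hk
    exact hx
  | succ k ih =>
    rw [mem_metricInterval] at hz
    obtain ⟨x', hxx, hx'⟩ := hG.1.exists_adj_dist (x := x) (y := z) (by
      rintro rfl; rw [dist_self] at hk; omega)
    have t1 := hG.1.dist_triangle (u := x') (v := z) (w := y)
    have t2 := hG.1.dist_le_succ hxx y
    rw [dist_comm (u := y), dist_comm (u := y)] at t2
    by_cases hx'' : x' ∈ G.halfspace a b
    · exact ih x' hx'' (by rw [mem_metricInterval]; omega) (by omega)
    · rw [← hG.halfspace_eq_of_crossing hab hxx hx hx'', mem_halfspace, dist_comm (u := y),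
        dist_comm (u := y)] at hy
      omega

/-- The Helly property for three convex sets. -/
theorem inter_inter_nonempty (hG : G.IsMedianGraph) {R S T : Set V}
    (hR : G.IsGeodesicallyConvex R) (hS : G.IsGeodesicallyConvex S)
    (hT : G.IsGeodesicallyConvex T) (hRS : (R ∩ S).Nonempty) (hST : (S ∩ T).Nonempty)
    (hTR : (T ∩ R).Nonempty) : (R ∩ T ∩ (S ∩ T)).Nonempty := by
  obtain ⟨x, hxR, hxS⟩ := hRS
  obtain ⟨y, hyS, hyT⟩ := hST
  obtain ⟨z, hzT, hzR⟩ := hTR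
  -- The median lies in all three sets. The goal repeats `T` because the induction for finitely many
  -- sets intersects each of them with the new one.
  obtain ⟨m, ⟨⟨h1, h2⟩, h3⟩, -⟩ := hG.2 x y z
  exact ⟨m, ⟨hR z hzR x hxR h3, hT y hyT z hzT h2⟩, hS x hxS y hyS h1, hT y hyT z hzT h2⟩

/-- The Helly property for finitely many convex sets. -/
theorem iInter_nonempty (hG : G.IsMedianGraph) {ι : Type*} (s : Finset ι) (f : ι → Set V)
    (hf : ∀ i ∈ s, G.IsGeodesicallyConvex (f i))
    (hs : ∀ i ∈ s, ∀ j ∈ s, (f i ∩ f j).Nonempty) : ∃ x, ∀ i ∈ s, x ∈ f i := by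
  classical
  induction s using Finset.induction_on generalizing f with
  | empty =>
    have := hG.1.nonempty
    exact ⟨Classical.arbitrary V, by simp⟩
  | insert k s hk ih =>
    rcases s.eq_empty_or_nonempty with rfl | ⟨i₀, hi₀⟩
    · obtain ⟨x, hx⟩ := hs k (by simp) k (by simp)
      exact ⟨x, by simpa using hx.1⟩
    have hk' := Finset.mem_insert_self k s
    have hi' : ∀ i ∈ s, i ∈ insert k s := fun i => Finset.mem_insert_of_mem
    obtain ⟨x, hx⟩ := ih (fun i => f i ∩ f k)
      (fun i hi => (hf i (hi' i hi)).inter (hf k hk'))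
      (fun i hi j hj => hG.inter_inter_nonempty (hf i (hi' i hi)) (hf j (hi' j hj)) (hf k hk')
        (hs i (hi' i hi) j (hi' j hj)) (hs j (hi' j hj) k hk') (hs k hk' i (hi' i hi)))
    refine ⟨x, fun i hi => ?_⟩
    rcases Finset.mem_insert.1 hi with rfl | hi
    · exact (hx i₀ hi₀).2
    · exact (hx i hi).1

/-- The halfspaces of a graph that do not contain the vertex `m`. -/
def _root_.SimpleGraph.halfspacesAvoiding (G : SimpleGraph V) (m : V) : Set (Set V) :=
  {H | m ∉ H ∧ ∃ a b, G.Adj a b ∧ G.halfspace a b = H}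

/-- Pairwise crossing halfspaces that avoid a common vertex are not more than the degree of some
vertex. -/
theorem card_le_of_pairwise_crossing [Finite V] (hG : G.IsMedianGraph) {m : V}
    (s : Finset (Set V)) (hs : (s : Set (Set V)) ⊆ G.halfspacesAvoiding m)
    (hanti : IsAntichain (· ≤ ·) (s : Set (Set V)))
    (hinter : ∀ H ∈ s, ∀ H' ∈ s, (H ∩ H').Nonempty) :
    ∃ z, s.card ≤ (G.neighborSet z).ncard := by
  classical
  have hconv : ∀ H ∈ s, G.IsGeodesicallyConvex H := by
    intro H hH
    obtain ⟨-, a, b, hab, rfl⟩ := hs hH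
    exact hG.isGeodesicallyConvex_halfspace hab
  have hconv' : ∀ H ∈ s, G.IsGeodesicallyConvex Hᶜ := by
    intro H hH
    obtain ⟨-, a, b, hab, rfl⟩ := hs hH
    rw [hG.compl_halfspace hab]
    exact hG.isGeodesicallyConvex_halfspace hab.symm
  have hZ : ({x | ∀ H ∈ s, x ∈ H} : Set V).Nonempty := hG.iInter_nonempty s id hconv hinter
  -- At the common vertex `z` nearest to `m`, each member `H` will yield a neighbor of `z` that lies
  -- outside `H` and inside all other members.
  obtain ⟨z, hz, hzmin⟩ := Set.exists_min_image _ (fun x => G.dist x m) (Set.toFinite _) hZ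
  have key : ∀ H ∈ s, ∃ y, G.Adj z y ∧ y ∉ H ∧ ∀ H' ∈ s, H' ≠ H → y ∈ H' := by
    intro H hH
    -- Helly with `H` replaced by its complement: the antichain condition makes the complement meet
    -- the other members.
    obtain ⟨p, hp⟩ := hG.iInter_nonempty s (fun H' => if H' = H then Hᶜ else H')
      (by
        intro H' hH'
        split_ifs
        · exact hconv' H hH
        · exact hconv H' hH')
      (by
        have hsub : ∀ H' ∈ s, H' ≠ H → (H' ∩ Hᶜ).Nonempty := fun H' hH' hne => by
          rw [Set.inter_compl_nonempty_iff]
          exact hanti hH' hH hne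
        intro H₁ h₁ H₂ h₂
        split_ifs with e₁ e₂ e₂
        · exact ⟨m, (hs hH).1, (hs hH).1⟩
        · rw [Set.inter_comm]
          exact hsub H₂ h₂ e₂
        · exact hsub H₁ h₁ e₁
        · exact hinter H₁ h₁ H₂ h₂)
    have hpH : p ∉ H := by simpa using hp H hH
    have hpH' : ∀ H' ∈ s, H' ≠ H → p ∈ H' := fun H' hH' hne => by simpa [hne] using hp H' hH'
    -- The median `q` is outside `H`, as `p` and `m` are. A step from `z` toward `q` approaches both
    -- `p` and `m`: it stays in the other members by convexity and leaves `H` by the choice of `z`.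
    obtain ⟨q, ⟨⟨h1, h2⟩, h3⟩, -⟩ := hG.2 z p m
    have hqH : q ∉ H := hconv' H hH p hpH m (hs hH).1 h2
    have hqz : z ≠ q := by
      rintro rfl
      exact hqH (hz H hH)
    obtain ⟨y, hzy, hy⟩ := hG.1.exists_adj_dist hqz
    rw [mem_metricInterval] at h1 h3
    have hym : G.dist y m < G.dist z m := by
      have := hG.1.dist_triangle (u := y) (v := q) (w := m)
      rw [dist_comm (u := m) (v := q), dist_comm (u := m) (v := z),
        dist_comm (u := q) (v := z)] at h3
      omega
    have hyp : y ∈ G.metricInterval z p := by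
      rw [mem_metricInterval]
      have t1 := hG.1.dist_triangle (u := y) (v := q) (w := p)
      have t2 := hG.1.dist_triangle (u := z) (v := y) (w := p)
      rw [dist_eq_one_iff_adj.2 hzy] at t2 ⊢
      omega
    have hyH' : ∀ H' ∈ s, H' ≠ H → y ∈ H' := fun H' hH' hne =>
      hconv H' hH' z (hz H' hH') p (hpH' H' hH' hne) hyp
    refine ⟨y, hzy, fun hyH => ?_, hyH'⟩
    have := hzmin y fun H' hH' => by
      by_cases hne : H' = H
      · rwa [hne]
      · exact hyH' H' hH' hne
    omega
  have : Nonempty V := ⟨z⟩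
  choose! y hy using key
  refine ⟨z, ?_⟩
  rw [← Set.ncard_coe_finset]
  refine Set.ncard_le_ncard_of_injOn y (fun H hH => (hy H hH).1) ?_ (Set.toFinite _)
  intro H hH H' hH' heq
  by_contra hne
  exact (hy H' hH').2.1 (heq ▸ (hy H hH).2.2 H' hH' (Ne.symm hne))

/-- The distance between two vertices is the number of halfspaces separating them. -/
theorem dist_eq_ncard [Finite V] (hG : G.IsMedianGraph) (m u v : V) :
    G.dist u v = {H ∈ G.halfspacesAvoiding m | ¬ (u ∈ H ↔ v ∈ H)}.ncard := by
  obtain ⟨k, hk⟩ : ∃ k, G.dist u v = k := ⟨_, rfl⟩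
  induction k generalizing u with
  | zero =>
    obtain rfl := hG.1.dist_eq_zero_iff.1 hk
    simp
  | succ k ih =>
    obtain ⟨w, huw, hw⟩ := hG.1.exists_adj_dist (x := u) (y := v) (by
      rintro rfl; rw [dist_self] at hk; omega)
    -- Exactly one side of the edge `uw` avoids `m`, so each class of parallel edges is counted
    -- once.
    obtain ⟨W, hWm, hW, hWu⟩ : ∃ W, m ∉ W ∧ (W = G.halfspace u w ∨ W = G.halfspace w u) ∧
        W ∈ G.halfspacesAvoiding m := by
      by_cases hm : m ∈ G.halfspace u w
      · have : m ∉ G.halfspace w u := (hG.notMem_halfspace huw.symm).2 hm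
        exact ⟨_, this, Or.inr rfl, this, w, u, huw.symm, rfl⟩
      · exact ⟨_, hm, Or.inl rfl, hm, u, w, huw, rfl⟩
    have hvw : v ∈ G.halfspace w u := by
      rw [mem_halfspace, dist_comm (u := v), dist_comm (u := v)]
      omega
    have hvu : v ∉ G.halfspace u w := (hG.notMem_halfspace huw).2 hvw
    have huu := mem_halfspace_left huw
    have huw' : u ∉ G.halfspace w u := (hG.notMem_halfspace huw.symm).2 huu
    have hww := mem_halfspace_left huw.symm
    have hwu : w ∉ G.halfspace u w := (hG.notMem_halfspace huw).2 hww
    -- Only `W` separates `u` from `w`, by `halfspace_eq_of_crossing`, and `w` is on the same side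
    -- of `W` as `v`.
    have hins : {H ∈ G.halfspacesAvoiding m | ¬ (u ∈ H ↔ v ∈ H)} =
        insert W {H ∈ G.halfspacesAvoiding m | ¬ (w ∈ H ↔ v ∈ H)} := by
      ext H
      simp only [Set.mem_insert_iff, Set.mem_ofPred_eq]
      constructor
      · rintro ⟨hH, hsep⟩
        by_cases heq : u ∈ H ↔ w ∈ H
        · exact Or.inr ⟨hH, by rwa [← heq]⟩
        · left
          obtain ⟨hmH, a, b, hab, rfl⟩ := hH
          by_cases huH : u ∈ G.halfspace a b
          · have hwH : w ∉ G.halfspace a b := fun h => heq (by tauto)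
            rw [← hG.halfspace_eq_of_crossing hab huw huH hwH] at hmH ⊢
            rcases hW with rfl | rfl
            · rfl
            · exact absurd ((hG.notMem_halfspace huw).1 hmH) hWm
          · have hwH : w ∈ G.halfspace a b := by tauto
            rw [← hG.halfspace_eq_of_crossing hab huw.symm hwH huH] at hmH ⊢
            rcases hW with rfl | rfl
            · exact absurd ((hG.notMem_halfspace huw.symm).1 hmH) hWm
            · rfl
      · rintro (rfl | ⟨hH, hsep⟩)
        · refine ⟨hWu, ?_⟩
          rcases hW with rfl | rfl <;> tauto
        · refine ⟨hH, fun hiff => ?_⟩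
          have hne : ¬ (u ∈ H ↔ w ∈ H) := by tauto
          obtain ⟨hmH, a, b, hab, rfl⟩ := hH
          by_cases huH : u ∈ G.halfspace a b
          · have hwH : w ∉ G.halfspace a b := fun h => hne (by tauto)
            rw [← hG.halfspace_eq_of_crossing hab huw huH hwH] at hiff
            tauto
          · have hwH : w ∈ G.halfspace a b := by tauto
            rw [← hG.halfspace_eq_of_crossing hab huw.symm hwH huH] at hiff
            tauto
    rw [hins, Set.ncard_insert_of_notMem _ (Set.toFinite _), ← ih w (by omega)]
    · omega
    · rintro ⟨-, h⟩
      rcases hW with rfl | rfl <;> tauto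

end IsMedianGraph

end SimpleGraph

/-! ### Set families without large crossing subfamilies -/

/-- The elements of a finite set can be numbered so that exactly those with the same image get the
same number. -/
theorem exists_numbering {α β : Type*} (s : Finset α) (f : α → β) :
    ∃ g : β → ℕ, (∀ x ∈ s, g (f x) < s.card) ∧
      ∀ x ∈ s, ∀ y ∈ s, g (f x) = g (f y) → f x = f y := by
  classical
  refine ⟨fun b => if h : b ∈ s.image f then ((s.image f).equivFin ⟨b, h⟩ : ℕ) else 0,
    fun x hx => ?_, fun x hx y hy hxy => ?_⟩
  · simp only [dif_pos (Finset.mem_image_of_mem f hx)]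
    exact (Fin.is_lt _).trans_le Finset.card_image_le
  · simp only [dif_pos (Finset.mem_image_of_mem f hx),
      dif_pos (Finset.mem_image_of_mem f hy)] at hxy
    simpa using (s.image f).equivFin.injective (Fin.ext hxy)

/-- A family of proper nonempty sets in which pairwise intersecting antichains have at most `k`
members is covered by chains, of which every point meets only few. -/
theorem exists_chain_cover {V : Type*} [Finite V] (F : Finset (Set V)) (k : ℕ)
    (hne : ∀ H ∈ F, H.Nonempty) (huniv : ∀ H ∈ F, H ≠ Set.univ)
    (hF : ∀ s ⊆ F, IsAntichain (· ≤ ·) (s : Set (Set V)) →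
      (∀ H ∈ s, ∀ H' ∈ s, (H ∩ H').Nonempty) → s.card ≤ k) :
    ∃ c : Set V → ℕ, (∀ H ∈ F, c H < F.card) ∧
      (∀ H ∈ F, ∀ H' ∈ F, c H = c H' → H ≤ H' ∨ H' ≤ H) ∧
      ∀ (u : V) (A : Finset (Set V)), A ⊆ F → (∀ H ∈ A, u ∈ H) →
        (A.image c).card ≤ Nat.clog 2 (Nat.card V) * k ^ 2 := by
  classical
  let level : Set V → ℕ := fun H => Nat.log 2 H.ncard
  have hlevel : ∀ H ∈ F, level H < Nat.clog 2 (Nat.card V) := by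
    intro H hH
    have h1 : H.ncard < Nat.card V := by
      rw [← Set.ncard_univ]
      exact Set.ncard_lt_ncard (Set.ssubset_univ_iff.2 (huniv H hH))
    have h2 : H.ncard ≠ 0 := ((Set.ncard_pos).2 (hne H hH)).ne'
    have h3 := Nat.pow_log_le_self 2 h2
    have h4 := Nat.le_pow_clog (b := 2) one_lt_two (Nat.card V)
    exact (Nat.pow_lt_pow_iff_right one_lt_two).1 ((h3.trans_lt h1).trans_le h4)
  -- `top H` is a maximal set above `H` among the sets of the same level.
  have htop : ∀ H ∈ F, ∃ E ∈ F, H ≤ E ∧ level E = level H ∧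
      ∀ E' ∈ F, level E' = level E → E ≤ E' → E' = E := by
    intro H hH
    obtain ⟨E, hHE, hE⟩ := (F.filter fun E => level E = level H).exists_le_maximal
      (Finset.mem_filter.2 ⟨hH, rfl⟩)
    have hE' := Finset.mem_filter.1 hE.prop
    refine ⟨E, hE'.1, hHE, hE'.2, fun E' h1 h2 h3 => ?_⟩
    exact (hE.2 (Finset.mem_filter.2 ⟨h1, h2.trans hE'.2⟩) h3).antisymm h3
  choose! top htopF htop_le htop_level htop_max using htop
  have hbelow : ∀ E ∈ F, ∃ f : Set V → ℕ, (∀ H ∈ F.filter (top · = E), f H < k) ∧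
      ∀ H ∈ F.filter (top · = E), ∀ H' ∈ F.filter (top · = E), f H = f H' → H ≤ H' ∨ H' ≤ H := by
    intro E _
    refine exists_chain_coloring _ _ fun t ht hta => hF t (ht.trans (Finset.filter_subset _ _))
      hta fun H hH H' hH' => ?_
    obtain ⟨h1, rfl⟩ := Finset.mem_filter.1 (ht hH)
    obtain ⟨h2, h3⟩ := Finset.mem_filter.1 (ht hH')
    -- Two disjoint sets of level `l` have at least `2 ^ (l + 1)` points together, too many for a
    -- set of level `l`.
    by_contra hdisj
    rw [Set.not_nonempty_iff_eq_empty, ← Set.disjoint_iff_inter_eq_empty] at hdisj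
    have h4 := Set.ncard_union_eq hdisj
    have h5 := Set.ncard_le_ncard (Set.union_subset (htop_le H h1) (h3 ▸ htop_le H' h2))
    have e1 : Nat.log 2 H.ncard = Nat.log 2 (top H).ncard := (htop_level H h1).symm
    have e2 : Nat.log 2 H'.ncard = Nat.log 2 (top H).ncard :=
      (htop_level H' h2).symm.trans (by rw [h3])
    have h6 := Nat.pow_log_le_self 2 (((Set.ncard_pos).2 (hne H h1)).ne')
    have h7 := Nat.pow_log_le_self 2 (((Set.ncard_pos).2 (hne H' h2)).ne')
    have h8 := Nat.lt_pow_succ_log_self (b := 2) one_lt_two (top H).ncard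
    rw [e1] at h6
    rw [e2] at h7
    rw [pow_succ] at h8
    omega
  choose! f hfk hfchain using hbelow
  -- A chain is named by a top and a Dilworth color below it.
  obtain ⟨g, hg, hg'⟩ := exists_numbering F fun H => (top H, f (top H) H)
  refine ⟨fun H => g (top H, f (top H) H), hg, fun H hH H' hH' heq => ?_, fun u A hA hu => ?_⟩
  · have := hg' H hH H' hH' heq
    rw [Prod.mk.injEq] at this
    refine hfchain (top H) (htopF H hH) H (Finset.mem_filter.2 ⟨hH, rfl⟩) H'
      (Finset.mem_filter.2 ⟨hH', this.1.symm⟩) ?_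
    rw [this.2, this.1]
  -- On each level, the tops of sets containing `u` form an antichain of sets through `u`, hence
  -- number at most `k`.
  · have htops : (A.image top).card ≤ Nat.clog 2 (Nat.card V) * k := by
      rw [Finset.card_eq_sum_card_fiberwise (f := level)
        (t := Finset.range (Nat.clog 2 (Nat.card V)))]
      · refine (Finset.sum_le_card_nsmul _ _ k fun j _ => ?_).trans (by simp)
        have hmem : ∀ E ∈ (A.image top).filter (level · = j),
            ∃ H ∈ A, top H = E ∧ level E = j := by
          intro E hE
          obtain ⟨hE, hj⟩ := Finset.mem_filter.1 hE
          obtain ⟨H, hH, rfl⟩ := Finset.mem_image.1 hE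
          exact ⟨H, hH, rfl, hj⟩
        refine hF _ ?_ ?_ ?_
        · intro E hE
          obtain ⟨H, hH, rfl, -⟩ := hmem E hE
          exact htopF H (hA hH)
        · intro E hE E' hE' hne hle
          obtain ⟨H, hH, rfl, hj⟩ := hmem E hE
          obtain ⟨H', hH', rfl, hj'⟩ := hmem E' hE'
          exact hne (htop_max H (hA hH) _ (htopF H' (hA hH')) (hj'.trans hj.symm) hle).symm
        · intro E hE E' hE'
          obtain ⟨H, hH, rfl, -⟩ := hmem E hE
          obtain ⟨H', hH', rfl, -⟩ := hmem E' hE'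
          exact ⟨u, htop_le H (hA hH) (hu H hH), htop_le H' (hA hH') (hu H' hH')⟩
      · intro E hE
        obtain ⟨H, hH, rfl⟩ := Finset.mem_image.1 hE
        simpa using hlevel _ (htopF H (hA hH))
    calc (A.image fun H => g (top H, f (top H) H)).card
        ≤ ((A.image top ×ˢ Finset.range k).image g).card := by
          refine Finset.card_le_card fun i hi => ?_
          obtain ⟨H, hH, rfl⟩ := Finset.mem_image.1 hi
          refine Finset.mem_image_of_mem g (Finset.mem_product.2
            ⟨Finset.mem_image_of_mem top hH, Finset.mem_range.2 ?_⟩)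
          exact hfk (top H) (htopF H (hA hH)) H (Finset.mem_filter.2 ⟨hA hH, rfl⟩)
      _ ≤ (A.image top).card * k := by
          refine Finset.card_image_le.trans ?_
          rw [Finset.card_product, Finset.card_range]
      _ ≤ Nat.clog 2 (Nat.card V) * k ^ 2 := by
          rw [pow_two, ← mul_assoc]
          exact Nat.mul_le_mul_right k htops

/-! ### Sparse vectors from chain covers -/

/-- The `ℓ₁`-distance of two vectors with values in `ℕ` of finite support. -/
noncomputable def sparseDist (f g : ℕ →₀ ℕ) : ℕ :=
  ∑ i ∈ f.support ∪ g.support, ((f i - g i) + (g i - f i))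

theorem sparseDist_eq_sum {f g : ℕ →₀ ℕ} {s : Finset ℕ} (hf : f.support ⊆ s)
    (hg : g.support ⊆ s) : sparseDist f g = ∑ i ∈ s, ((f i - g i) + (g i - f i)) := by
  refine Finset.sum_subset (Finset.union_subset hf hg) fun i _ hi => ?_
  simp only [Finset.mem_union, Finsupp.mem_support_iff, not_or, not_not] at hi
  simp [hi.1, hi.2]

/-- Counting the members containing a point of each chain of a chain cover turns the number of
separating members into an `ℓ₁`-distance. -/
theorem exists_sparse_vectors {V : Type*} (F : Finset (Set V)) (c : Set V → ℕ)
    (hc : ∀ H ∈ F, c H < F.card)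
    (hchain : ∀ H ∈ F, ∀ H' ∈ F, c H = c H' → H ≤ H' ∨ H' ≤ H) (k : ℕ)
    (hk : ∀ (u : V) (A : Finset (Set V)), A ⊆ F → (∀ H ∈ A, u ∈ H) → (A.image c).card ≤ k) :
    ∃ a : V → ℕ →₀ ℕ,
      (∀ u v, sparseDist (a u) (a v) = {H ∈ (F : Set (Set V)) | ¬ (u ∈ H ↔ v ∈ H)}.ncard) ∧
      ∀ u, (a u).support.card ≤ k ∧ ∀ i ∈ (a u).support, i < F.card ∧ a u i ≤ F.card := by
  classical
  let A : V → ℕ → Finset (Set V) := fun u i => F.filter fun H => c H = i ∧ u ∈ H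
  have hsupp : ∀ u i, (A u i).card ≠ 0 → i ∈ (F.filter (u ∈ ·)).image c := by
    intro u i h
    obtain ⟨H, hH⟩ := Finset.card_ne_zero.1 h
    obtain ⟨h1, h2, h3⟩ := Finset.mem_filter.1 hH
    exact Finset.mem_image.2 ⟨H, Finset.mem_filter.2 ⟨h1, h3⟩, h2⟩
  let a : V → ℕ →₀ ℕ := fun u => Finsupp.onFinset _ (fun i => (A u i).card) (hsupp u)
  have hasub : ∀ u, (a u).support ⊆ (F.filter (u ∈ ·)).image c :=
    fun u => Finsupp.support_onFinset_subset
  have hrange : ∀ u, (a u).support ⊆ Finset.range F.card := fun u i hi => by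
    obtain ⟨H, hH, rfl⟩ := Finset.mem_image.1 (hasub u hi)
    exact Finset.mem_range.2 (hc H (Finset.mem_filter.1 hH).1)
  refine ⟨a, fun u v => ?_, fun u => ⟨?_, fun i hi => ⟨?_, ?_⟩⟩⟩
  · have hset : {H ∈ (F : Set (Set V)) | ¬ (u ∈ H ↔ v ∈ H)} =
        ((F.filter fun H => ¬ (u ∈ H ↔ v ∈ H) : Finset (Set V)) : Set (Set V)) := by
      ext H; simp
    have hfiber : ∀ H ∈ F.filter fun H => ¬ (u ∈ H ↔ v ∈ H), c H ∈ Finset.range F.card :=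
      fun H hH => Finset.mem_range.2 (hc H (Finset.mem_filter.1 hH).1)
    rw [sparseDist_eq_sum (hrange u) (hrange v), hset, Set.ncard_coe_finset,
      Finset.card_eq_sum_card_fiberwise hfiber]
    refine Finset.sum_congr rfl fun i _ => ?_
    have hsep : (F.filter fun H => ¬ (u ∈ H ↔ v ∈ H)).filter (c · = i) =
        (A u i \ A v i) ∪ (A v i \ A u i) := by
      ext H
      simp only [A, Finset.mem_filter, Finset.mem_union, Finset.mem_sdiff]
      tauto
    change ((A u i).card - (A v i).card) + ((A v i).card - (A u i).card) = _
    rw [hsep]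
    -- Within a chain, the members containing a point are closed under passing to larger members, so
    -- two such families are nested and their symmetric difference is counted by the difference of
    -- cardinals.
    have hnested : A u i ⊆ A v i ∨ A v i ⊆ A u i := by
      by_contra! hcon
      obtain ⟨H, hH, hH'⟩ := Finset.not_subset.1 hcon.1
      obtain ⟨E, hE, hE'⟩ := Finset.not_subset.1 hcon.2
      simp only [A, Finset.mem_filter, not_and] at hH hH' hE hE'
      rcases hchain H hH.1 E hE.1 (hH.2.1.trans hE.2.1.symm) with h | h
      · exact hE' hE.1 hE.2.1 (h hH.2.2)
      · exact hH' hH.1 hH.2.1 (h hE.2.2)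
    rcases hnested with h | h
    · rw [Finset.sdiff_eq_empty_iff_subset.2 h, Finset.empty_union, Finset.card_sdiff_of_subset h,
        Nat.sub_eq_zero_of_le (Finset.card_le_card h), zero_add]
    · rw [Finset.sdiff_eq_empty_iff_subset.2 h, Finset.union_empty, Finset.card_sdiff_of_subset h,
        Nat.sub_eq_zero_of_le (Finset.card_le_card h), add_zero]
  · exact (Finset.card_le_card (hasub u)).trans
      (hk u _ (Finset.filter_subset _ _) fun H hH => (Finset.mem_filter.1 hH).2)
  · exact Finset.mem_range.1 (hrange u hi)
  · exact Finset.card_le_card (Finset.filter_subset _ _)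

/-! ### Labeling schemes for median graphs -/

namespace SimpleGraph

/-- A crude count by ordered pairs suffices, since only the logarithm enters the label length. -/
theorem ncard_halfspacesAvoiding_le {V : Type u} [Finite V] (G : SimpleGraph V) (m : V) :
    (G.halfspacesAvoiding m).ncard ≤ Nat.card V ^ 2 := by
  calc (G.halfspacesAvoiding m).ncard
      ≤ ((fun p : V × V => G.halfspace p.1 p.2) '' Set.univ).ncard := by
        refine Set.ncard_le_ncard ?_ (Set.toFinite _)
        rintro H ⟨-, a, b, -, rfl⟩
        exact ⟨(a, b), trivial, rfl⟩
    _ ≤ (Set.univ : Set (V × V)).ncard := Set.ncard_image_le (Set.toFinite _)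
    _ = Nat.card V ^ 2 := by rw [Set.ncard_univ, Nat.card_prod, pow_two]

/-- A median graph of bounded degree embeds isometrically into the sparse vectors. -/
theorem IsMedianGraph.exists_sparse_embedding {V : Type u} [Finite V] {G : SimpleGraph V}
    (hG : G.IsMedianGraph) {Δ : ℕ} (hΔ : ∀ v, (G.neighborSet v).ncard ≤ Δ) :
    ∃ a : V → ℕ →₀ ℕ, (∀ u v, sparseDist (a u) (a v) = G.dist u v) ∧
      ∀ u, (encodeSparse (a u)).length ≤
        Nat.clog 2 (Nat.card V) * Δ ^ 2 * (16 * Nat.clog 2 (Nat.card V) + 13) := by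
  classical
  have := hG.1.nonempty
  obtain ⟨m⟩ := this
  obtain ⟨F, hF⟩ : ∃ F : Finset (Set V), (F : Set (Set V)) = G.halfspacesAvoiding m :=
    ⟨(Set.toFinite (G.halfspacesAvoiding m)).toFinset, by simp⟩
  have hmem : ∀ H, H ∈ F ↔ H ∈ G.halfspacesAvoiding m := fun H => by
    rw [← hF, Finset.mem_coe]
  obtain ⟨c, hc, hchain, hcount⟩ := exists_chain_cover F Δ
    (fun H hH => by
      obtain ⟨-, a, b, hab, rfl⟩ := (hmem H).1 hH
      exact ⟨a, mem_halfspace_left hab⟩)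
    (fun H hH h => ((hmem H).1 hH).1 (h ▸ trivial))
    (fun s hs hanti hinter => by
      obtain ⟨z, hz⟩ := hG.card_le_of_pairwise_crossing s
        (fun H hH => (hmem H).1 (hs hH)) hanti hinter
      exact hz.trans (hΔ z))
  obtain ⟨a, ha, hbound⟩ := exists_sparse_vectors F c hc hchain _ hcount
  refine ⟨a, fun u v => by rw [ha, hF, ← hG.dist_eq_ncard m u v], fun u => ?_⟩
  -- The extra one makes the bound strict; with this number of bits, `8 * b + 5` becomes `16 *
  -- Nat.clog 2 (Nat.card V) + 13`.
  have hcard : F.card < 2 ^ (2 * Nat.clog 2 (Nat.card V) + 1) := by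
    have h1 := G.ncard_halfspacesAvoiding_le m
    rw [← hF, Set.ncard_coe_finset] at h1
    have h2 := Nat.pow_le_pow_left (Nat.le_pow_clog (b := 2) one_lt_two (Nat.card V)) 2
    rw [← pow_mul, mul_comm] at h2
    exact (h1.trans h2).trans_lt (Nat.pow_lt_pow_right one_lt_two (Nat.lt_succ_self _))
  refine (length_encodeSparse_le (hbound u).1 fun i hi =>
    ⟨((hbound u).2 i hi).1.trans hcard, ((hbound u).2 i hi).2.trans_lt hcard⟩).trans
      (Nat.mul_le_mul_left _ (by omega))

end SimpleGraph

/-- The distance labeling scheme given by the embedding into sparse vectors. -/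
noncomputable def medianDistanceScheme (Δ : ℕ) :
    DistanceLabelingScheme (medianGraphsOfMaxDegree.{u} Δ) where
  encode _ hG x :=
    haveI := hG.1
    encodeSparse (Classical.choose (hG.2.1.exists_sparse_embedding hG.2.2) x)
  decode v w :=
    sparseDist (Function.invFun encodeSparse v) (Function.invFun encodeSparse w)
  decode_encode G hG x y := by
    have := hG.1
    rw [Function.leftInverse_invFun encodeSparse_injective,
      Function.leftInverse_invFun encodeSparse_injective]
    exact (Classical.choose_spec (hG.2.1.exists_sparse_embedding hG.2.2)).1 x y

theorem length_medianDistanceScheme_le {Δ : ℕ} {V : Type u} {G : SimpleGraph V}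
    (hG : medianGraphsOfMaxDegree Δ V G) (x : V) :
    ((medianDistanceScheme Δ).encode G hG x).length ≤
      Nat.clog 2 (Nat.card V) * Δ ^ 2 * (16 * Nat.clog 2 (Nat.card V) + 13) := by
  have := hG.1
  exact (Classical.choose_spec (hG.2.1.exists_sparse_embedding hG.2.2)).2 x

/-- The neighbor reached through a port. -/
noncomputable def PortAssignment.neighbor {V : Type u} {G : SimpleGraph V} (P : PortAssignment G)
    (x : V) (i : ℕ) : V :=
  @Function.invFunOn _ _ ⟨x⟩ (P.port x) (G.neighborSet x) i

theorem PortAssignment.neighbor_port {V : Type u} {G : SimpleGraph V} (P : PortAssignment G)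
    {x z : V} (h : G.Adj x z) : P.neighbor x (P.port x z) = z :=
  have : Nonempty V := ⟨x⟩
  (P.bijOn x).injOn.leftInvOn_invFunOn h

theorem PortAssignment.neighbor_spec {V : Type u} {G : SimpleGraph V} (P : PortAssignment G)
    {x : V} {i : ℕ} (hi : i ∈ Set.Icc 1 (G.neighborSet x).ncard) :
    G.Adj x (P.neighbor x i) ∧ P.port x (P.neighbor x i) = i := by
  have : Nonempty V := ⟨x⟩
  have h := (P.bijOn x).surjOn hi
  exact ⟨Function.invFunOn_mem h, Function.invFunOn_eq h⟩

open Classical in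
/-- A distance labeling scheme yields a routing labeling scheme: a vertex gets its own distance
label and those of its neighbors in the order of the ports. -/
noncomputable def DistanceLabelingScheme.toRouting {F : GraphFamily.{u}}
    (S : DistanceLabelingScheme F) (hF : ∀ (V : Type u) (G : SimpleGraph V), F V G → G.Connected) :
    RoutingLabelingScheme F where
  encode {V} G hG P x :=
    -- On one vertex the required bound is zero and there is nothing to route, so the label must be
    -- and can be empty.
    if Nat.card V = 1 then [] else encodeStrings (S.encode G hG x ::
      (List.range (G.neighborSet x).ncard).map fun i => S.encode G hG (P.neighbor x (i + 1)))
  decode v w :=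
    let l := Function.invFun encodeStrings v
    let t := (Function.invFun encodeStrings w).headI
    -- The first neighbor one step closer to the target is chosen; ports start at one, positions at
    -- zero.
    l.tail.findIdx (fun s => decide (S.decode s t + 1 = S.decode l.headI t)) + 1
  decode_encode {V} G hG P x y hxy := by
    have hconn := hF V G hG
    have hcard : Nat.card V ≠ 1 := fun h =>
      hxy (@Subsingleton.elim _ (Nat.card_eq_one_iff_unique.1 h).1 x y)
    simp only [if_neg hcard, Function.leftInverse_invFun encodeStrings_injective _,
      List.headI_cons, List.tail_cons, S.decode_encode]
    set l := (List.range (G.neighborSet x).ncard).map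
      fun i => S.encode G hG (P.neighbor x (i + 1)) with hl
    obtain ⟨z, hxz, hz⟩ := hconn.exists_adj_dist hxy
    have hport := (P.bijOn x).mapsTo hxz
    have hlt : l.findIdx (fun s => decide (S.decode s (S.encode G hG y) + 1 = G.dist x y)) <
        l.length := by
      rw [List.findIdx_lt_length]
      refine ⟨S.encode G hG z, ?_, by simpa [S.decode_encode] using hz⟩
      rw [hl, List.mem_map]
      refine ⟨P.port x z - 1, List.mem_range.2 ?_, ?_⟩
      · have := hport.1; have := hport.2; omega
      · rw [Nat.sub_add_cancel hport.1, P.neighbor_port hxz]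
    have hget := List.findIdx_getElem (w := hlt)
    generalize l.findIdx (fun s => decide (S.decode s (S.encode G hG y) + 1 = G.dist x y)) = i
      at hlt hget ⊢
    have hi : i + 1 ∈ Set.Icc 1 (G.neighborSet x).ncard := by
      rw [hl, List.length_map, List.length_range] at hlt
      exact ⟨by omega, hlt⟩
    simp only [hl, List.getElem_map, List.getElem_range, S.decode_encode, decide_eq_true_eq]
      at hget
    obtain ⟨hadj, hp⟩ := P.neighbor_spec hi
    refine ⟨_, hadj, ?_, hp.symm⟩
    rw [SimpleGraph.mem_metricInterval, SimpleGraph.dist_eq_one_iff_adj.2 hadj]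
    omega

theorem DistanceLabelingScheme.length_toRouting_le {F : GraphFamily.{u}}
    (S : DistanceLabelingScheme F) (hF : ∀ (V : Type u) (G : SimpleGraph V), F V G → G.Connected)
    {V : Type u} {G : SimpleGraph V} (hG : F V G) (P : PortAssignment G) (x : V) {k Δ : ℕ}
    (hk : ∀ y, (S.encode G hG y).length ≤ k) (hΔ : (G.neighborSet x).ncard ≤ Δ)
    (hV : Nat.card V ≠ 1) :
    ((S.toRouting hF).encode G hG P x).length ≤ (Δ + 1) * (2 * k + 1) := by
  simp only [toRouting, if_neg hV]
  refine (length_encodeStrings_le (k := k) fun w hw => ?_).trans ?_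
  · rcases List.mem_cons.1 hw with rfl | hw
    · exact hk x
    · obtain ⟨i, -, rfl⟩ := List.mem_map.1 hw
      exact hk _
  · rw [List.length_cons, List.length_map, List.length_range]
    gcongr

/-! ### Numerical estimates and conclusion -/

/-- Absorbs the cubic dependence on the degree. From `n = 3` on, the cube grows by a factor below
two; the constant 8 is attained there. -/
theorem add_one_pow_three_le (n : ℕ) : (n + 1) ^ 3 ≤ 8 * 2 ^ n := by
  rcases lt_or_ge n 3 with h | h
  · interval_cases n <;> norm_num
  · induction n, h using Nat.le_induction with
    | base => norm_num
    | succ n hn ih =>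
      have : (n + 1 + 1) ^ 3 ≤ 2 * (n + 1) ^ 3 := by
        obtain ⟨m, rfl⟩ := Nat.exists_eq_add_of_le hn
        ring_nf
        nlinarith [sq_nonneg m]
      calc (n + 1 + 1) ^ 3 ≤ 2 * (n + 1) ^ 3 := this
        _ ≤ 2 * (8 * 2 ^ n) := Nat.mul_le_mul_left 2 ih
        _ = 8 * 2 ^ (n + 1) := by ring

theorem clog_le_two_mul_logb {n : ℕ} (hn : 2 ≤ n) :
    1 ≤ Real.logb 2 n ∧ (Nat.clog 2 n : ℝ) ≤ 2 * Real.logb 2 n := by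
  have h1 : 1 ≤ Real.logb 2 n := by
    rw [Real.le_logb_iff_rpow_le one_lt_two (by positivity), Real.rpow_one]
    exact_mod_cast hn
  refine ⟨h1, ?_⟩
  have h2 : (Nat.log 2 n : ℝ) ≤ Real.logb 2 n := by exact_mod_cast Real.natLog_le_logb n 2
  have h3 : Nat.clog 2 n ≤ Nat.log 2 n + 1 :=
    Nat.clog_le_of_le_pow (Nat.lt_pow_succ_log_self one_lt_two n).le
  have h4 : (Nat.clog 2 n : ℝ) ≤ Nat.log 2 n + 1 := by exact_mod_cast h3
  linarith

theorem mainTheorem8 :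
    ∃ C : ℝ, ∀ Δ : ℕ,
      (∃ S : DistanceLabelingScheme (medianGraphsOfMaxDegree.{u} Δ),
        ∀ (V : Type u) (G : SimpleGraph V) (hG : medianGraphsOfMaxDegree Δ V G) (x : V),
          ((S.encode G hG x).length : ℝ) ≤ C * 2 ^ Δ * Real.logb 2 (Nat.card V : ℝ) ^ 3) ∧
      (∃ R : RoutingLabelingScheme (medianGraphsOfMaxDegree.{u} Δ),
        ∀ (V : Type u) (G : SimpleGraph V) (hG : medianGraphsOfMaxDegree Δ V G)
          (P : PortAssignment G) (x : V),
          ((R.encode G hG P x).length : ℝ) ≤ C * 2 ^ Δ * Real.logb 2 (Nat.card V : ℝ) ^ 3) := by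
  -- `1864 = 8 * 233`, where `233 = 2 * 116 + 1` comes from delimiting the labels, `116 = 4 * 29`
  -- from `Nat.clog` being at most twice the logarithm, and `29 = 16 + 13`.
  refine ⟨1864, fun Δ => ?_⟩
  have hpow : ((Δ : ℝ) + 1) ^ 3 ≤ 8 * 2 ^ Δ := by exact_mod_cast add_one_pow_three_le Δ
  have hΔ0 : (0 : ℝ) ≤ Δ := Δ.cast_nonneg
  -- the label lengths in terms of the logarithm
  have hlen : ∀ (V : Type u) (G : SimpleGraph V) (hG : medianGraphsOfMaxDegree Δ V G) (x : V),
      2 ≤ Nat.card V → (((medianDistanceScheme Δ).encode G hG x).length : ℝ) ≤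
        116 * (Δ : ℝ) ^ 2 * Real.logb 2 (Nat.card V) ^ 2 := by
    intro V G hG x hV
    obtain ⟨h1, h2⟩ := clog_le_two_mul_logb hV
    have h3 : (((medianDistanceScheme Δ).encode G hG x).length : ℝ) ≤
        (Nat.clog 2 (Nat.card V) : ℝ) * Δ ^ 2 * (16 * Nat.clog 2 (Nat.card V) + 13) := by
      exact_mod_cast length_medianDistanceScheme_le hG x
    have h4 : (1 : ℝ) ≤ Nat.clog 2 (Nat.card V) := by
      exact_mod_cast Nat.clog_pos one_lt_two hV
    calc (((medianDistanceScheme Δ).encode G hG x).length : ℝ)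
        ≤ (Nat.clog 2 (Nat.card V) : ℝ) * Δ ^ 2 * (16 * Nat.clog 2 (Nat.card V) + 13) := h3
      _ ≤ (Nat.clog 2 (Nat.card V) : ℝ) * Δ ^ 2 * (29 * Nat.clog 2 (Nat.card V)) := by
          gcongr; linarith
      _ = 29 * (Δ : ℝ) ^ 2 * (Nat.clog 2 (Nat.card V) : ℝ) ^ 2 := by ring
      _ ≤ 29 * (Δ : ℝ) ^ 2 * (2 * Real.logb 2 (Nat.card V)) ^ 2 := by gcongr
      _ = 116 * (Δ : ℝ) ^ 2 * Real.logb 2 (Nat.card V) ^ 2 := by ring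
  have hsize : ∀ (V : Type u) (G : SimpleGraph V), medianGraphsOfMaxDegree Δ V G →
      Nat.card V = 1 ∨ 2 ≤ Nat.card V := by
    intro V G hG
    have := hG.1
    have := hG.2.1.1.nonempty
    have : 0 < Nat.card V := Nat.card_pos
    omega
  refine ⟨⟨medianDistanceScheme Δ, fun V G hG x => ?_⟩,
    ⟨(medianDistanceScheme Δ).toRouting fun V G hG => hG.2.1.1, fun V G hG P x => ?_⟩⟩
  · rcases hsize V G hG with hV | hV
    · have := length_medianDistanceScheme_le hG x
      rw [hV] at this ⊢
      simpa using this
    · have h1 := (clog_le_two_mul_logb hV).1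
      calc (((medianDistanceScheme Δ).encode G hG x).length : ℝ)
          ≤ 116 * (Δ : ℝ) ^ 2 * Real.logb 2 (Nat.card V) ^ 2 := hlen V G hG x hV
        _ ≤ 233 * ((Δ : ℝ) + 1) ^ 3 * Real.logb 2 (Nat.card V) ^ 3 := by
            gcongr ?_ * ?_ * ?_
            · norm_num
            · nlinarith [sq_nonneg (Δ : ℝ), mul_nonneg hΔ0 (sq_nonneg (Δ : ℝ))]
            · exact pow_le_pow_right₀ h1 (by norm_num)
        _ ≤ 233 * (8 * 2 ^ Δ) * Real.logb 2 (Nat.card V) ^ 3 := by gcongr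
        _ = 1864 * 2 ^ Δ * Real.logb 2 (Nat.card V) ^ 3 := by ring
  · rcases hsize V G hG with hV | hV
    · simp [DistanceLabelingScheme.toRouting, hV]
    · have h1 := (clog_le_two_mul_logb hV).1
      set L := Real.logb 2 (Nat.card V) with hL
      have hk : ∀ y, ((medianDistanceScheme Δ).encode G hG y).length ≤
          ⌊116 * (Δ : ℝ) ^ 2 * L ^ 2⌋₊ := fun y => Nat.le_floor (hlen V G hG y hV)
      have h2 := (medianDistanceScheme Δ).length_toRouting_le (fun V G hG => hG.2.1.1) hG P x hk
        (hG.2.2 x) (by omega)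
      have h3 : (⌊116 * (Δ : ℝ) ^ 2 * L ^ 2⌋₊ : ℝ) ≤ 116 * (Δ : ℝ) ^ 2 * L ^ 2 :=
        Nat.floor_le (by positivity)
      have hL2 : 1 ≤ L ^ 2 := one_le_pow₀ h1
      calc _ ≤ (((Δ + 1) * (2 * ⌊116 * (Δ : ℝ) ^ 2 * L ^ 2⌋₊ + 1) : ℕ) : ℝ) := by
            exact_mod_cast h2
        _ = ((Δ : ℝ) + 1) * (2 * ⌊116 * (Δ : ℝ) ^ 2 * L ^ 2⌋₊ + 1) := by push_cast; ring
        _ ≤ ((Δ : ℝ) + 1) * (2 * (116 * (Δ : ℝ) ^ 2 * L ^ 2) + L ^ 2) := by gcongr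
        _ = ((Δ : ℝ) + 1) * (232 * (Δ : ℝ) ^ 2 + 1) * L ^ 2 := by ring
        _ ≤ ((Δ : ℝ) + 1) * (233 * ((Δ : ℝ) + 1) ^ 2) * L ^ 3 := by
            gcongr ?_ * ?_ * ?_
            · nlinarith
            · exact pow_le_pow_right₀ h1 (by norm_num)
        _ = 233 * ((Δ : ℝ) + 1) ^ 3 * L ^ 3 := by ring
        _ ≤ 233 * (8 * 2 ^ Δ) * L ^ 3 := by gcongr
        _ = 1864 * 2 ^ Δ * L ^ 3 := by ring
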